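/- Let $M$ be a connected smooth 3-manifold (without boundary) with a smooth Riemannian metric $g$, equipped with an orientation and a spin structure. Since the spinor bundle of such a manifold is trivial, present the spin structure by a smooth global orthonormal frame $e_1,e_2,e_3$; spinor fields are then functions $\eta:M\to\mathbb C^2$, the Pauli matrices are $\sigma^\alpha=\sum_j e_j{}^\alpha s_j$ (where $s_1,s_2,s_3$ are the standard Pauli matrices), $\sigma_0=I=-\sigma^0$, and $$\nabla_\alpha\eta=\partial_\alpha\eta+\tfrac14\sigma_\beta\bigl(\partial_\alpha\sigma^\beta+\Gamma^\beta{}_{\alpha\gamma}\sigma^\gamma\bigr)\eta ,$$ where $\Gamma$ denotes the Christoffel symbols of $g$. Let $p_0\neq 0$ be a real number and consider the stationary Lagrangian density, given in local coordinates by $$L(\eta)=\frac{16}{9\,\bar\eta\sigma_0\eta}\Bigl(\bigl[\tfrac i2(\bar\eta\,\sigma^\alpha\nabla_\alpha\eta-\eta\,\sigma^\alpha\nabla_\alpha\bar\eta)\bigr]^2-(p_0\,\bar\eta\sigma_0\eta)^2\Bigr)\sqrt{\det g},$$ where $\bar\eta\,\sigma^\alpha\nabla_\alpha\eta=\bar\eta^{\dot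 a}\sigma^\alpha{}_{\dot ab}\nabla_\alpha\eta^b$, $\eta\,\sigma^\alpha\nabla_\alpha\bar\eta=\eta^b\sigma^\alpha{}_{\dot ab}\nabla_\alpha\bar\eta^{\dot a}$ and $\bar\eta\sigma_0\eta=\bar\eta^{\dot a}\sigma_{0\dot ab}\eta^b$. Let $\eta$ be a nowhere vanishing spinor field of class $C^2$ on $M$. Then $\eta$ satisfies the field (Euler--Lagrange) equation of $L$, that is, $$\frac{d}{dt}\Big|_{t=0}\int L(\eta+t\varphi)\,dx^1dx^2dx^3=0$$ for every smooth spinor field $\varphi$ with compact support in a coordinate chart (the integral being taken over the support of $\varphi$), if and only if $\eta$ satisfies one of the two stationary Weyl equations $$\pm p_0\,\sigma^0\eta+i\,\sigma^\alpha\nabla_\alpha\eta=0$$ on all of $M$. -/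

import Mathlib

open scoped Manifold ContDiff Matrix

attribute [local instance 2000] chartedSpaceSelf

/-- The model space of a 3-manifold. -/
abbrev E3 : Type := EuclideanSpace ℝ (Fin 3)

/-- The space of two-component complex spinors, a spinor being `(ξ¹, ξ²)`. -/
abbrev Spinor : Type := Fin 2 → ℂ

/-- The standard Pauli matrices `s₁, s₂, s₃`. -/
def pauli : Fin 3 → Matrix (Fin 2) (Fin 2) ℂ :=
  ![!![0, 1; 1, 0], !![0, -Complex.I; Complex.I, 0], !![1, 0; 0, -1]]

/-- The Pauli matrix `σ_0` (lower index), the identity matrix. -/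
def sigmaLowerZero : Matrix (Fin 2) (Fin 2) ℂ := 1

/-- The Pauli matrix `σ^0` (upper index). The time index is lowered and raised with the metric
`-(dx⁰)² + g`, so that `σ^0 = -σ_0`. -/
def sigmaUpperZero : Matrix (Fin 2) (Fin 2) ℂ := -1

section Geometry

variable {M : Type*} [TopologicalSpace M] [ChartedSpace E3 M] [IsManifold 𝓘(ℝ, E3) ∞ M]

/-- A smooth Riemannian metric `g` on the 3-manifold `M`. -/
abbrev RiemMetric (M : Type*) [TopologicalSpace M] [ChartedSpace E3 M]
    [IsManifold 𝓘(ℝ, E3) ∞ M] :=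
  Bundle.ContMDiffRiemannianMetric 𝓘(ℝ, E3) ∞ E3 (fun x : M => TangentSpace 𝓘(ℝ, E3) x)

/-- A smooth global `g`-orthonormal frame `e₁, e₂, e₃` on `M`. It determines the Pauli matrices
`σ^α = ∑ j, e_j^α s_j` of the Riemannian manifold, which satisfy
`σ^α σ^β + σ^β σ^α = 2 g^{αβ}`, and conversely every smooth field of triples of trace-free Hermitian
`2 × 2` matrices with this property is of this form. Such a frame is the same as an orientation and
a spin structure whose spinor bundle is trivialised; as the spinor bundle of an oriented Riemannian
3-manifold with spin structure is always trivial (its structure group is `SU(2)`), every spin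
structure arises in this way, and spinor fields are functions with values in `ℂ²`. -/
structure OrthonormalFrame (g : RiemMetric M) where
  /-- The vector fields of the frame. -/
  vec : Fin 3 → (x : M) → TangentSpace 𝓘(ℝ, E3) x
  smooth : ∀ j, ContMDiff 𝓘(ℝ, E3) 𝓘(ℝ, E3).tangent ∞
    (fun x => (⟨x, vec j x⟩ : TangentBundle 𝓘(ℝ, E3) M))
  orthonormal : ∀ x j k, g.inner x (vec j x) (vec k x) = if j = k then 1 else 0

variable {g : RiemMetric M}

/-- The coefficients `g([e_i, e_j], e_k)` of the Lie brackets of the frame. -/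
noncomputable def bracketCoeff (e : OrthonormalFrame g) (i j k : Fin 3) (x : M) : ℝ :=
  g.inner x (VectorField.mlieBracket 𝓘(ℝ, E3) (e.vec i) (e.vec j) x) (e.vec k x)

/-- The coefficients `g(∇_{e_i} e_j, e_k)` of the Levi-Civita connection in the orthonormal frame,
given by the Koszul formula
`2 g(∇_{e_i} e_j, e_k) = g([e_i, e_j], e_k) - g([e_j, e_k], e_i) + g([e_k, e_i], e_j)`. -/
noncomputable def connectionCoeff (e : OrthonormalFrame g) (i j k : Fin 3) (x : M) : ℝ :=
  (bracketCoeff e i j k x - bracketCoeff e j k i x + bracketCoeff e k i j x) / 2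

theorem bracketCoeff_swap (e : OrthonormalFrame g) (i j k : Fin 3) (x : M) :
    bracketCoeff e j i k x = -bracketCoeff e i j k x := by
  unfold bracketCoeff
  rw [VectorField.mlieBracket_swap_apply, map_neg, neg_apply]

/-- The connection is metric. -/
theorem connectionCoeff_antisymm (e : OrthonormalFrame g) (i j k : Fin 3) (x : M) :
    connectionCoeff e i k j x = -connectionCoeff e i j k x := by
  unfold connectionCoeff
  rw [bracketCoeff_swap e k i j x, bracketCoeff_swap e j k i x, bracketCoeff_swap e i j k x]
  ring

/-- The connection is torsion free: `∇_{e_i} e_j - ∇_{e_j} e_i = [e_i, e_j]`. -/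
theorem connectionCoeff_torsionFree (e : OrthonormalFrame g) (i j k : Fin 3) (x : M) :
    connectionCoeff e i j k x - connectionCoeff e j i k x = bracketCoeff e i j k x := by
  unfold connectionCoeff
  rw [bracketCoeff_swap e i k j x, bracketCoeff_swap e k j i x, bracketCoeff_swap e i j k x,
    bracketCoeff_swap e k i j x, bracketCoeff_swap e j k i x]
  ring

/-- The derivative `e_i^α ∂_α η` of (the components of) a spinor field along `e_i`. -/
noncomputable def frameDeriv (e : OrthonormalFrame g) (η : M → Spinor) (i : Fin 3) (x : M) :
    Spinor :=
  mfderiv 𝓘(ℝ, E3) 𝓘(ℝ, Spinor) η x (e.vec i x)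

/-- The covariant derivative `∇_{e_i} η = e_i^α ∇_α η` of a spinor field,
`∇_α η = ∂_α η + ¼ σ_β (∂_α σ^β + Γ^β_{αγ} σ^γ) η`, where `Γ` denotes the Christoffel symbols.
The bracket is the Levi-Civita derivative of the matrix-valued vector field `∑ j, s_j e_j`, hence
the second term, taken along `e_i`, is `¼ ∑ j k, g(∇_{e_i} e_j, e_k) s_k s_j η`. -/
noncomputable def spinorDeriv (e : OrthonormalFrame g) (η : M → Spinor) (i : Fin 3) (x : M) :
    Spinor :=
  frameDeriv e η i x +
    (1 / 4 : ℂ) • ∑ j, ∑ k, (connectionCoeff e i j k x : ℂ) • ((pauli k * pauli j) *ᵥ η x)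

/-- The real scalar `(i/2) (η̄ σ^α ∇_α η - η σ^α ∇_α η̄)`, as a complex number. -/
noncomputable def weylForm (e : OrthonormalFrame g) (η : M → Spinor) (x : M) : ℂ :=
  Complex.I / 2 * ∑ j, (star (η x) ⬝ᵥ (pauli j *ᵥ spinorDeriv e η j x) -
    star (spinorDeriv e η j x) ⬝ᵥ (pauli j *ᵥ η x))

/-- The real scalar `η̄ σ_0 η`, as a complex number. -/
noncomputable def spinorNorm (η : M → Spinor) (x : M) : ℂ :=
  star (η x) ⬝ᵥ (sigmaLowerZero *ᵥ η x)

theorem weylForm_im (e : OrthonormalFrame g) (η : M → Spinor) (x : M) :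
    (weylForm e η x).im = 0 := by
  unfold weylForm
  generalize spinorDeriv e η = d
  simp [pauli, Fin.sum_univ_three, Matrix.mulVec, dotProduct, Fin.sum_univ_two]
  ring

/-- The square root of the determinant of the metric in the local coordinates of the chart `c`,
at the point with coordinates `y`. -/
noncomputable def sqrtDetMetric (g : RiemMetric M) (c : OpenPartialHomeomorph M E3) (y : E3) : ℝ :=
  √(Matrix.of fun α β : Fin 3 => g.inner (c.symm y)
    (mfderiv 𝓘(ℝ, E3) 𝓘(ℝ, E3) c.symm y (EuclideanSpace.single α (1 : ℝ)))
    (mfderiv 𝓘(ℝ, E3) 𝓘(ℝ, E3) c.symm y (EuclideanSpace.single β (1 : ℝ)))).det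

/-- The stationary Lagrangian density `L(η)` with parameter `p₀`, in the local coordinates of the
chart `c`, at the point with coordinates `y`:
`16 / (9 η̄ σ_0 η) * ([(i/2) (η̄ σ^α ∇_α η - η σ^α ∇_α η̄)]² - (p₀ η̄ σ_0 η)²) * √(det g)`. -/
noncomputable def stationaryLagrangian (e : OrthonormalFrame g) (p₀ : ℝ) (η : M → Spinor)
    (c : OpenPartialHomeomorph M E3) (y : E3) : ℝ :=
  16 / (9 * (spinorNorm η (c.symm y)).re) *
    ((weylForm e η (c.symm y)).re ^ 2 - (p₀ * (spinorNorm η (c.symm y)).re) ^ 2) *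
    sqrtDetMetric g c y

/-- `η` satisfies the field (Euler–Lagrange) equation of the stationary Lagrangian density: the
first variation of the action `∫ L(η) dx¹dx²dx³` vanishes for all smooth variations `φ` with compact
support in a coordinate chart. As `L(η + t φ)` depends on `t` only over the support of `φ`,
the action is integrated over this compact set. -/
def SolvesFieldEquation (e : OrthonormalFrame g) (p₀ : ℝ) (η : M → Spinor) : Prop :=
  ∀ c ∈ IsManifold.maximalAtlas 𝓘(ℝ, E3) ∞ M, ∀ φ : M → Spinor,
    ContMDiff 𝓘(ℝ, E3) 𝓘(ℝ, Spinor) ∞ φ → HasCompactSupport φ → tsupport φ ⊆ c.source →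
    HasDerivAt (fun t : ℝ => ∫ y in c '' tsupport φ,
      stationaryLagrangian e p₀ (fun x => η x + (t : ℂ) • φ x) c y) 0 0

/-- `η` satisfies the stationary Weyl equation `p σ^0 η + i σ^α ∇_α η = 0`. -/
def SolvesWeyl (e : OrthonormalFrame g) (p : ℝ) (η : M → Spinor) : Prop :=
  ∀ x, (p : ℂ) • (sigmaUpperZero *ᵥ η x) +
    Complex.I • ∑ j, pauli j *ᵥ spinorDeriv e η j x = 0

end Geometry

open MeasureTheory Topology VectorField

/-! Write `D = i σ^α ∇_α`, `ρ = η̄ σ_0 η`, `W = Re (η̄ D η)` and `u = W / ρ`. Up to the factor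
`√(det g)` the Lagrangian is `16/9 (W²/ρ - p₀² ρ)`, with first variation `16/9 (2u δW - (u² + p₀²)
δρ)`. In an orthonormal frame (`weylOperator_eq`), `D` is `∑ i s_j e_j + ½ ∑ div(e_j) i s_j` plus a
real scalar. The half divergence is exactly what makes `D` formally self-adjoint, so by
`lagrangian_variation_eq` and `integral_divergence_eq_zero` the field equation reads `i σ^α (∂_α u)
η + 2u Dη - (u² + p₀²) η = 0`.

Take the real pairing of this equation with `η`. The gradient term vanishes because `i s_j` is
skew-Hermitian, and `Re (η̄ D η) = uρ`, which leaves `(u² - p₀²) ρ = 0`. So the continuous function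
`u` takes only the values `±p₀ ≠ 0`; as `M` is connected, `u` is constant, and the equation
collapses to `2u (Dη - uη) = 0`, a Weyl equation since `σ^0 = -1`. Conversely, `Dη = pη` with `p =
±p₀` forces `u = p`, and the field equation holds identically. -/

/-! ### Differentiation under the integral and integration by parts. -/

/-- Dominated differentiation: the `t`-derivative is continuous, hence bounded, on a compact set,
and constants are integrable over `K`. -/
theorem hasDerivAt_setIntegral_of_continuousOn {E : Type*} [TopologicalSpace E] [T2Space E]
    [MeasurableSpace E] [OpensMeasurableSpace E] {μ : Measure E} [IsFiniteMeasureOnCompacts μ]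
    {K : Set E} (hK : IsCompact K) {F F' : ℝ → E → ℝ} {ε : ℝ} (hε : 0 < ε)
    (hF : ∀ t ∈ Set.Icc (-ε) ε, ContinuousOn (F t) K)
    (hF' : ContinuousOn (fun p : ℝ × E => F' p.1 p.2) (Set.Icc (-ε) ε ×ˢ K))
    (hderiv : ∀ t ∈ Set.Icc (-ε) ε, ∀ y ∈ K, HasDerivAt (fun t => F t y) (F' t y) t) :
    HasDerivAt (fun t => ∫ y in K, F t y ∂μ) (∫ y in K, F' 0 y ∂μ) 0 := by
  obtain ⟨C, hC⟩ := (isCompact_Icc.prod hK).exists_bound_of_continuousOn hF'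
  have hnhds : Set.Icc (-ε) ε ∈ 𝓝 (0 : ℝ) := Icc_mem_nhds (by linarith) hε
  have h0 : (0 : ℝ) ∈ Set.Icc (-ε) ε := mem_of_mem_nhds hnhds
  have hF'0 : ContinuousOn (F' 0) K :=
    hF'.comp (f := fun y => ((0 : ℝ), y)) (by fun_prop) fun y hy => ⟨h0, hy⟩
  refine (hasDerivAt_integral_of_dominated_loc_of_deriv_le (bound := fun _ => C) hnhds
    ?_ ((hF 0 h0).integrableOn_compact hK)
    (hF'0.integrableOn_compact hK).aestronglyMeasurable ?_ ?_ ?_).2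
  · filter_upwards [hnhds] with t ht
    exact ((hF t ht).integrableOn_compact hK).aestronglyMeasurable
  · exact (ae_restrict_iff' hK.measurableSet).2 (ae_of_all _ fun y hy t ht => hC (t, y) ⟨ht, hy⟩)
  · exact integrableOn_const hK.measure_lt_top.ne
  · exact (ae_restrict_iff' hK.measurableSet).2 (ae_of_all _ fun y hy t ht => hderiv t ht y hy)

theorem integral_fderiv_apply_eq_zero {E : Type*} [NormedAddCommGroup E] [NormedSpace ℝ E]
    [FiniteDimensional ℝ E] [MeasurableSpace E] [BorelSpace E] {μ : Measure E}
    [μ.IsAddHaarMeasure] {h : E → ℝ} (hh : ContDiff ℝ 1 h) (hc : HasCompactSupport h) (v : E) :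
    Integrable (fun y => fderiv ℝ h y v) μ ∧ ∫ y, fderiv ℝ h y v ∂μ = 0 := by
  have hint : Integrable (fun y => fderiv ℝ h y v) μ :=
    (hh.continuous_fderiv_apply one_ne_zero |>.comp (by fun_prop : Continuous fun y => (y, v))
      ).integrable_of_hasCompactSupport (hc.fderiv_apply ℝ v)
  have := integral_mul_fderiv_eq_neg_fderiv_mul_of_integrable (𝕜 := ℝ) (μ := μ) (f := fun _ => 1)
    (g := h) (v := v) (by simp) (by simpa using hint)
    (by simpa using hh.continuous.integrable_of_hasCompactSupport hc)
    (by intros; fun_prop) (fun x _ => (hh.differentiable one_ne_zero) x)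
  exact ⟨hint, by simpa using this⟩

/-! ### Determinants of frames in coordinates. -/

/-- The determinant of the components of three vectors. -/
noncomputable def frameDet (v : Fin 3 → E3) : ℝ :=
  (Matrix.of fun j α => v j α).det

theorem frameDet_eq (v : Fin 3 → E3) : frameDet v =
    v 0 0 * v 1 1 * v 2 2 - v 0 0 * v 1 2 * v 2 1 - v 0 1 * v 1 0 * v 2 2
      + v 0 1 * v 1 2 * v 2 0 + v 0 2 * v 1 0 * v 2 1 - v 0 2 * v 1 1 * v 2 0 := by
  simp [frameDet, Matrix.det_fin_three]

/-- This is the derivative at `t = 0` of `det (1 + tB)` times the determinant of `v`. It turns the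
coordinate divergence of a frame field into a sum of determinants. -/
theorem sum_frameDet_update_clm (v : Fin 3 → E3) (B : E3 →L[ℝ] E3) :
    ∑ k, frameDet (Function.update v k (B (v k))) =
      (∑ α, B (EuclideanSpace.single α 1) α) * frameDet v := by
  have hB : ∀ k α, B (v k) α = ∑ β, v k β * B (EuclideanSpace.single β 1) α := by
    intro k α
    have h1 : v k = ∑ β, v k β • EuclideanSpace.single β (1 : ℝ) := by
      ext β; simp [Fin.sum_univ_three]; fin_cases β <;> simp
    conv_lhs => rw [h1]
    simp
  simp only [frameDet_eq, Fin.sum_univ_three, Function.update_apply]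
  simp [hB, Fin.sum_univ_three]
  ring

theorem hasFDerivAt_frameDet {E : Fin 3 → E3 → E3} {y : E3} (hE : ∀ j, DifferentiableAt ℝ (E j) y) :
    ∃ D' : E3 →L[ℝ] ℝ, HasFDerivAt (fun z => frameDet fun j => E j z) D' y ∧
      ∀ v, D' v = ∑ k, frameDet (Function.update (fun j => E j y) k (fderiv ℝ (E k) y v)) := by
  have h : ∀ j α, HasFDerivAt (fun z => E j z α)
      ((EuclideanSpace.proj α : E3 →L[ℝ] ℝ).comp (fderiv ℝ (E j) y)) y := fun j α =>
    (EuclideanSpace.proj α : E3 →L[ℝ] ℝ).hasFDerivAt.comp y (hE j).hasFDerivAt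
  have hd := (((((((h 0 0).mul (h 1 1)).mul (h 2 2)).sub (((h 0 0).mul (h 1 2)).mul (h 2 1))).sub
    (((h 0 1).mul (h 1 0)).mul (h 2 2))).add (((h 0 1).mul (h 1 2)).mul (h 2 0))).add
    (((h 0 2).mul (h 1 0)).mul (h 2 1))).sub (((h 0 2).mul (h 1 1)).mul (h 2 0))
  refine ⟨_, hd.congr_of_eventuallyEq (.of_forall fun z => frameDet_eq _), fun v => ?_⟩
  simp only [frameDet_eq, Fin.sum_univ_three, Function.update_apply]
  simp
  ring

/-- Jacobi's formula for the volume density of a frame: the divergence of a frame field is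
the trace of the Lie brackets with the frame. -/
theorem sum_fderiv_inv_abs_frameDet_mul {E : Fin 3 → E3 → E3} {y : E3}
    (hE : ∀ j, DifferentiableAt ℝ (E j) y) (hD : frameDet (fun j => E j y) ≠ 0) (i : Fin 3) :
    DifferentiableAt ℝ (fun z => |frameDet fun j => E j z|⁻¹) y ∧
    fderiv ℝ (fun z => |frameDet fun j => E j z|⁻¹) y (E i y) +
      |frameDet fun j => E j y|⁻¹ * ∑ α, fderiv ℝ (E i) y (EuclideanSpace.single α 1) α =
      |frameDet fun j => E j y|⁻¹ * ∑ k, frameDet (Function.update (fun j => E j y) k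
        (VectorField.lieBracket ℝ (E k) (E i) y)) / frameDet (fun j => E j y) := by
  obtain ⟨D', hD', hv⟩ := hasFDerivAt_frameDet hE
  have habs := (hasDerivAt_abs hD).comp_hasFDerivAt y hD'
  have hinv := (hasDerivAt_inv (abs_ne_zero.2 hD)).comp_hasFDerivAt y habs
  refine ⟨hinv.differentiableAt, ?_⟩
  have hf : fderiv ℝ (fun z => |frameDet fun j => E j z|⁻¹) y = _ := hinv.fderiv
  have htr := sum_frameDet_update_clm (fun j => E j y) (fderiv ℝ (E i) y)
  have hsub : ∀ k (a b : E3), frameDet (Function.update (fun j => E j y) k (a - b)) =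
      frameDet (Function.update (fun j => E j y) k a) -
      frameDet (Function.update (fun j => E j y) k b) := by
    intro k a b
    fin_cases k <;> simp [frameDet_eq] <;> ring
  rw [hf, ← Finset.sum_div]
  -- Since `[E k, E i] = (D E_i)(E k) - (D E_k)(E i)`, the first half sums to the trace of `D E_i`
  -- and the second to the derivative of the determinant along `E i`.
  simp only [VectorField.lieBracket, hsub, Finset.sum_sub_distrib, htr, ← hv]
  rcases lt_or_gt_of_ne hD with h | h
  · simp [sign_neg h, abs_of_neg h]
    field_simp
    ring
  · simp [sign_pos h, abs_of_pos h]
    field_simp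
    ring

/-! ### The orthonormal frame and the metric in a chart. -/

section FrameInChart

theorem contMDiffAt_chart_symm {M : Type*} [TopologicalSpace M] [ChartedSpace E3 M]
    {c : OpenPartialHomeomorph M E3} (hc : c ∈ IsManifold.maximalAtlas 𝓘(ℝ, E3) ∞ M) {y : E3}
    (hy : y ∈ c.target) : ContMDiffAt 𝓘(ℝ, E3) 𝓘(ℝ, E3) ∞ c.symm y :=
  (contMDiffOn_symm_of_mem_maximalAtlas hc).contMDiffAt (c.open_target.mem_nhds hy)

theorem isInvertible_mfderiv_chart_symm {M : Type*} [TopologicalSpace M] [ChartedSpace E3 M]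
    [IsManifold 𝓘(ℝ, E3) 1 M]
    {c : OpenPartialHomeomorph M E3} (hc : c ∈ IsManifold.maximalAtlas 𝓘(ℝ, E3) ∞ M) {y : E3}
    (hy : y ∈ c.target) : (mfderiv 𝓘(ℝ, E3) 𝓘(ℝ, E3) c.symm y).IsInvertible := by
  have h : c.MDifferentiable 𝓘(ℝ, E3) 𝓘(ℝ, E3) :=
    ⟨(contMDiffOn_of_mem_maximalAtlas hc).mdifferentiableOn (by simp),
      (contMDiffOn_symm_of_mem_maximalAtlas hc).mdifferentiableOn (by simp)⟩
  exact ⟨h.symm.mfderiv hy, rfl⟩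

variable {M : Type*} [TopologicalSpace M] [ChartedSpace E3 M] [IsManifold 𝓘(ℝ, E3) ∞ M]
  {g : RiemMetric M}

/-- The derivative of a vector-valued function along the `j`-th vector field of the frame. -/
noncomputable def frameLineDeriv (e : OrthonormalFrame g) {V : Type*} [NormedAddCommGroup V]
    [NormedSpace ℝ V] (f : M → V) (j : Fin 3) (x : M) : V :=
  mfderiv 𝓘(ℝ, E3) 𝓘(ℝ, V) f x (e.vec j x)

theorem contMDiff_frameLineDeriv (e : OrthonormalFrame g) {V : Type*} [NormedAddCommGroup V]
    [NormedSpace ℝ V] {f : M → V} {m n : ℕ∞} (hf : ContMDiff 𝓘(ℝ, E3) 𝓘(ℝ, V) n f)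
    (hmn : m + 1 ≤ n) (j : Fin 3) :
    ContMDiff 𝓘(ℝ, E3) 𝓘(ℝ, V) m (frameLineDeriv e f j) := by
  have h1 : ContMDiff 𝓘(ℝ, E3).tangent 𝓘(ℝ, V).tangent m (tangentMap 𝓘(ℝ, E3) 𝓘(ℝ, V) f) :=
    hf.contMDiff_tangentMap (by exact_mod_cast hmn)
  have h2 := h1.comp ((e.smooth j).of_le (m := m) (by exact_mod_cast le_top))
  exact (contMDiff_snd_tangentBundle_modelSpace V 𝓘(ℝ, V)).comp h2

theorem contMDiff_bracketCoeff (e : OrthonormalFrame g) (i j k : Fin 3) :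
    ContMDiff 𝓘(ℝ, E3) 𝓘(ℝ) ∞ (bracketCoeff e i j k) := by
  have : IsManifold 𝓘(ℝ, E3) ((⊤ : ℕ∞) + 1) M := by assumption
  have : IsManifold 𝓘(ℝ, E3) (minSmoothness ℝ 2) M :=
    .of_le (n := ∞) (by simp; exact WithTop.coe_le_coe.2 le_top)
  have h : ContMDiff 𝓘(ℝ, E3) 𝓘(ℝ, E3).tangent ∞
      (fun x => (⟨x, mlieBracket 𝓘(ℝ, E3) (e.vec i) (e.vec j) x⟩ : TangentBundle 𝓘(ℝ, E3) M)) :=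
    fun x => ContMDiffAt.mlieBracket_vectorField (m := ⊤) (n := ⊤) (e.smooth i x) (e.smooth j x)
      (by simp)
  have h3 := ContMDiff.clm_bundle_apply₂ (F₁ := E3) (F₂ := E3) (F₃ := ℝ)
    (E₃ := Bundle.Trivial M ℝ) g.contMDiff h (e.smooth k)
  intro x
  have := h3 x
  simp only [Bundle.contMDiffAt_totalSpace] at this
  exact this.2

/-- The vector field `e_j` of the frame in the coordinates of the chart `c`. -/
noncomputable def chartFrame (e : OrthonormalFrame g) (c : OpenPartialHomeomorph M E3) (j : Fin 3) :
    E3 → E3 :=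
  mpullback 𝓘(ℝ, E3) 𝓘(ℝ, E3) c.symm (e.vec j)

theorem contDiffAt_chartFrame (e : OrthonormalFrame g) {c : OpenPartialHomeomorph M E3}
    (hc : c ∈ IsManifold.maximalAtlas 𝓘(ℝ, E3) ∞ M) {y : E3} (hy : y ∈ c.target) (j : Fin 3) :
    ContDiffAt ℝ ∞ (chartFrame e c j) y := by
  refine contMDiffAt_vectorSpace_iff_contDiffAt.1 ?_
  exact ContMDiffAt.mpullback_vectorField_preimage (n := ∞) (e.smooth j _)
    (contMDiffAt_chart_symm hc hy) (isInvertible_mfderiv_chart_symm hc hy) (by simp)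

theorem mfderiv_chart_symm_chartFrame (e : OrthonormalFrame g) {c : OpenPartialHomeomorph M E3}
    (hc : c ∈ IsManifold.maximalAtlas 𝓘(ℝ, E3) ∞ M) {y : E3} (hy : y ∈ c.target) (j : Fin 3) :
    mfderiv 𝓘(ℝ, E3) 𝓘(ℝ, E3) c.symm y (chartFrame e c j y) = e.vec j (c.symm y) :=
  (isInvertible_mfderiv_chart_symm hc hy).self_apply_inverse _

theorem fderiv_comp_chart_symm (e : OrthonormalFrame g) {c : OpenPartialHomeomorph M E3}
    (hc : c ∈ IsManifold.maximalAtlas 𝓘(ℝ, E3) ∞ M) {y : E3} (hy : y ∈ c.target)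
    {V : Type*} [NormedAddCommGroup V] [NormedSpace ℝ V] {f : M → V}
    (hf : MDifferentiableAt 𝓘(ℝ, E3) 𝓘(ℝ, V) f (c.symm y)) (j : Fin 3) :
    fderiv ℝ (f ∘ c.symm) y (chartFrame e c j y) =
      frameLineDeriv e f j (c.symm y) := by
  rw [frameLineDeriv, ← mfderiv_eq_fderiv, mfderiv_comp y hf
    ((contMDiffAt_chart_symm hc hy).mdifferentiableAt (by simp)),
    ← mfderiv_chart_symm_chartFrame e hc hy]
  rfl

theorem mfderiv_chart_symm_lieBracket (e : OrthonormalFrame g) {c : OpenPartialHomeomorph M E3}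
    (hc : c ∈ IsManifold.maximalAtlas 𝓘(ℝ, E3) ∞ M) {y : E3} (hy : y ∈ c.target) (i j : Fin 3) :
    mfderiv 𝓘(ℝ, E3) 𝓘(ℝ, E3) c.symm y
      (lieBracket ℝ (chartFrame e c i) (chartFrame e c j) y : E3) =
    mlieBracket 𝓘(ℝ, E3) (e.vec i) (e.vec j) (c.symm y) := by
  have : IsManifold 𝓘(ℝ, E3) (minSmoothness ℝ 2) M :=
    .of_le (n := ∞) (by simp; exact WithTop.coe_le_coe.2 le_top)
  have h := mpullback_mlieBracket (n := ∞) ((e.smooth i _).mdifferentiableAt (by simp))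
    ((e.smooth j _).mdifferentiableAt (by simp)) (contMDiffAt_chart_symm hc hy)
    (by simp; exact WithTop.coe_le_coe.2 le_top)
  rw [← mlieBracketWithin_univ (V := mpullback _ _ _ _), mlieBracketWithin_eq_lieBracketWithin] at h
  have h' : lieBracket ℝ (chartFrame e c i) (chartFrame e c j) y =
      mpullback 𝓘(ℝ, E3) 𝓘(ℝ, E3) c.symm (mlieBracket 𝓘(ℝ, E3) (e.vec i) (e.vec j)) y :=
    (congrFun lieBracketWithin_univ.symm y).trans h.symm
  rw [h']
  exact (isInvertible_mfderiv_chart_symm hc hy).self_apply_inverse _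

theorem EuclideanSpace.bilin_apply_eq_sum {B : E3 → E3 → ℝ}
    (h₁ : ∀ w, IsLinearMap ℝ fun v => B v w) (h₂ : ∀ v, IsLinearMap ℝ (B v)) (v w : E3) :
    B v w = ∑ α, v α * ∑ β, B (EuclideanSpace.single α 1) (EuclideanSpace.single β 1) * w β := by
  have h : ∀ v : E3, v = ∑ β, v β • EuclideanSpace.single β (1 : ℝ) := by
    intro v
    ext β; simp [Fin.sum_univ_three]; fin_cases β <;> simp
  have e₁ : ∀ w, B v w = ∑ α, v α * B (EuclideanSpace.single α 1) w := fun w => by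
    conv_lhs => rw [h v]
    refine (map_sum (IsLinearMap.mk' _ (h₁ w)) (fun α => v α • EuclideanSpace.single α 1)
      .univ).trans ?_
    simp
  have e₂ : ∀ v, B v w = ∑ β, B v (EuclideanSpace.single β 1) * w β := fun v => by
    conv_lhs => rw [h w]
    refine (map_sum (IsLinearMap.mk' _ (h₂ v)) (fun α => w α • EuclideanSpace.single α 1)
      .univ).trans ?_
    simp [mul_comm]
  rw [e₁]
  exact Finset.sum_congr rfl fun α _ => by rw [e₂]

theorem inner_mfderiv_chart_symm (g : RiemMetric M) (c : OpenPartialHomeomorph M E3) (y v w : E3) :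
    g.inner (c.symm y) (mfderiv 𝓘(ℝ, E3) 𝓘(ℝ, E3) c.symm y v)
      (mfderiv 𝓘(ℝ, E3) 𝓘(ℝ, E3) c.symm y w) =
    ∑ α, v α * ∑ β, (g.inner (c.symm y)
      (mfderiv 𝓘(ℝ, E3) 𝓘(ℝ, E3) c.symm y (EuclideanSpace.single α (1 : ℝ)))
      (mfderiv 𝓘(ℝ, E3) 𝓘(ℝ, E3) c.symm y (EuclideanSpace.single β (1 : ℝ))) * w β) :=
  EuclideanSpace.bilin_apply_eq_sum (B := fun v w => g.inner (c.symm y)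
      (mfderiv 𝓘(ℝ, E3) 𝓘(ℝ, E3) c.symm y v) (mfderiv 𝓘(ℝ, E3) 𝓘(ℝ, E3) c.symm y w))
    (fun _ => ⟨fun a b : TangentSpace 𝓘(ℝ, E3) y =>
        DFunLike.congr_fun (((g.inner _).congr_arg (map_add _ a b)).trans (map_add _ _ _)) _,
      fun r (a : TangentSpace 𝓘(ℝ, E3) y) =>
        DFunLike.congr_fun (((g.inner _).congr_arg (map_smul _ r a)).trans (map_smul _ _ _)) _⟩)
    (fun _ => ⟨fun a b : TangentSpace 𝓘(ℝ, E3) y => ((g.inner _ _).congr_arg (map_add _ a b)).trans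
        (map_add _ _ _),
      fun r (a : TangentSpace 𝓘(ℝ, E3) y) => ((g.inner _ _).congr_arg (map_smul _ r a)).trans
        (map_smul _ _ _)⟩) v w

/-- Orthonormality in coordinates. Its determinant gives the independence of the frame and the value
of `det g`; the same product in the other order expands vectors in the frame. -/
theorem matrix_frame_mul_metric (e : OrthonormalFrame g) {c : OpenPartialHomeomorph M E3}
    (hc : c ∈ IsManifold.maximalAtlas 𝓘(ℝ, E3) ∞ M) {y : E3} (hy : y ∈ c.target) :
    (Matrix.of fun j α => chartFrame e c j y α) * ((Matrix.of fun α β : Fin 3 => g.inner (c.symm y)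
    (mfderiv 𝓘(ℝ, E3) 𝓘(ℝ, E3) c.symm y (EuclideanSpace.single α (1 : ℝ)))
    (mfderiv 𝓘(ℝ, E3) 𝓘(ℝ, E3) c.symm y (EuclideanSpace.single β (1 : ℝ)))) *
    (Matrix.of fun j α => chartFrame e c j y α)ᵀ) = 1 := by
  ext j k
  rw [Matrix.one_apply, ← e.orthonormal (c.symm y) j k, ← mfderiv_chart_symm_chartFrame e hc hy j,
    ← mfderiv_chart_symm_chartFrame e hc hy k, inner_mfderiv_chart_symm]
  simp [Matrix.mul_apply]

theorem frameDet_chartFrame_ne_zero (e : OrthonormalFrame g) {c : OpenPartialHomeomorph M E3}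
    (hc : c ∈ IsManifold.maximalAtlas 𝓘(ℝ, E3) ∞ M) {y : E3} (hy : y ∈ c.target) :
    frameDet (fun j => chartFrame e c j y) ≠ 0 := by
  have := congrArg Matrix.det (matrix_frame_mul_metric e hc hy)
  rw [Matrix.det_mul, Matrix.det_one] at this
  exact left_ne_zero_of_mul_eq_one this

theorem sqrtDetMetric_eq (e : OrthonormalFrame g) {c : OpenPartialHomeomorph M E3}
    (hc : c ∈ IsManifold.maximalAtlas 𝓘(ℝ, E3) ∞ M) {y : E3} (hy : y ∈ c.target) :
    sqrtDetMetric g c y = |frameDet fun j => chartFrame e c j y|⁻¹ := by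
  have h := congrArg Matrix.det (matrix_frame_mul_metric e hc hy)
  rw [Matrix.det_mul, Matrix.det_mul, Matrix.det_transpose, Matrix.det_one] at h
  have h0 := frameDet_chartFrame_ne_zero e hc hy
  unfold sqrtDetMetric
  change frameDet _ * (_ * frameDet _) = 1 at h
  rw [← Real.sqrt_sq_eq_abs, ← Real.sqrt_inv]
  congr 1
  field_simp
  linarith

/-- Cramer's rule: the coefficients of a vector in an orthonormal frame are its inner products with
the frame, and replacing the `k`-th column vector isolates the `k`-th of them. -/
theorem bracketCoeff_mul_frameDet (e : OrthonormalFrame g) {c : OpenPartialHomeomorph M E3}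
    (hc : c ∈ IsManifold.maximalAtlas 𝓘(ℝ, E3) ∞ M) {y : E3} (hy : y ∈ c.target) (i j k : Fin 3) :
    frameDet (Function.update (fun j => chartFrame e c j y) k
        (lieBracket ℝ (chartFrame e c i) (chartFrame e c j) y)) =
      bracketCoeff e i j k (c.symm y) * frameDet (fun j => chartFrame e c j y) := by
  have h := matrix_frame_mul_metric e hc hy
  unfold bracketCoeff
  rw [← mfderiv_chart_symm_lieBracket e hc hy]
  generalize lieBracket ℝ (chartFrame e c i) (chartFrame e c j) y = v
  have hinner : ∀ l, g.inner (c.symm y) (mfderiv 𝓘(ℝ, E3) 𝓘(ℝ, E3) c.symm y v)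
      (e.vec l (c.symm y)) = Matrix.vecMul v ((Matrix.of fun α β : Fin 3 => g.inner (c.symm y)
      (mfderiv 𝓘(ℝ, E3) 𝓘(ℝ, E3) c.symm y (EuclideanSpace.single α (1 : ℝ)))
      (mfderiv 𝓘(ℝ, E3) 𝓘(ℝ, E3) c.symm y (EuclideanSpace.single β (1 : ℝ)))) *
      (Matrix.of fun j α => chartFrame e c j y α)ᵀ) l := by
    intro l
    rw [← mfderiv_chart_symm_chartFrame e hc hy, inner_mfderiv_chart_symm]
    simp [Matrix.vecMul, dotProduct, Matrix.mul_apply]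
  have hexp := congrArg (Matrix.vecMul v) (mul_eq_one_comm.1 h)
  rw [← Matrix.vecMul_vecMul, Matrix.vecMul_one] at hexp
  rw [hinner]
  generalize Matrix.vecMul v _ = a at hexp ⊢
  have hexp' : ∀ α, v α = ∑ l, a l * chartFrame e c l y α := fun α => by
    rw [← hexp]
    rfl
  fin_cases k <;> simp [frameDet_eq, hexp', Fin.sum_univ_three] <;> ring

end FrameInChart

/-! ### The divergence theorem in a chart. -/

section Divergence

theorem EuclideanSpace.clm_apply_eq_sum (L : E3 →L[ℝ] ℝ) (v : E3) :
    L v = ∑ α, v α * L (EuclideanSpace.single α 1) := by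
  have h : v = ∑ β, v β • EuclideanSpace.single β (1 : ℝ) := by
    ext β; simp [Fin.sum_univ_three]; fin_cases β <;> simp
  conv_lhs => rw [h]
  simp

variable {M : Type*} [TopologicalSpace M] [ChartedSpace E3 M] [IsManifold 𝓘(ℝ, E3) ∞ M]
  {g : RiemMetric M}

theorem contDiffAt_frameDet_chartFrame (e : OrthonormalFrame g) {c : OpenPartialHomeomorph M E3}
    (hc : c ∈ IsManifold.maximalAtlas 𝓘(ℝ, E3) ∞ M) {y : E3} (hy : y ∈ c.target) :
    ContDiffAt ℝ ∞ (fun z => |frameDet fun j => chartFrame e c j z|⁻¹) y := by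
  have h : ∀ j α, ContDiffAt ℝ ∞ (fun z => chartFrame e c j z α) y := fun j α =>
    (EuclideanSpace.proj α : E3 →L[ℝ] ℝ).contDiff.contDiffAt.comp y
      (contDiffAt_chartFrame e hc hy j)
  have hD : ContDiffAt ℝ ∞ (fun z => frameDet fun j => chartFrame e c j z) y := by
    simp only [frameDet_eq]
    fun_prop
  have h0 := frameDet_chartFrame_ne_zero e hc hy
  exact (hD.abs h0).inv (abs_ne_zero.2 h0)

theorem continuousAt_sqrtDetMetric (e : OrthonormalFrame g) {c : OpenPartialHomeomorph M E3}
    (hc : c ∈ IsManifold.maximalAtlas 𝓘(ℝ, E3) ∞ M) {y : E3} (hy : y ∈ c.target) :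
    ContinuousAt (sqrtDetMetric g c) y :=
  (contDiffAt_frameDet_chartFrame e hc hy).continuousAt.congr (by
    filter_upwards [c.open_target.mem_nhds hy] with z hz using (sqrtDetMetric_eq e hc hz).symm)

/-- The divergence of the vector field `e_j`. -/
noncomputable def divCoeff (e : OrthonormalFrame g) (j : Fin 3) (x : M) : ℝ :=
  ∑ k, bracketCoeff e k j k x

/-- The divergence of the vector field `P e_j`, in coordinates. -/
theorem sum_fderiv_chart_divergence (e : OrthonormalFrame g) {c : OpenPartialHomeomorph M E3}
    (hc : c ∈ IsManifold.maximalAtlas 𝓘(ℝ, E3) ∞ M) {y : E3} (hy : y ∈ c.target)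
    {P : M → ℝ} (hP : MDifferentiableAt 𝓘(ℝ, E3) 𝓘(ℝ) P (c.symm y)) (j : Fin 3) :
    ∑ α, fderiv ℝ (fun z => P (c.symm z) *
        (|frameDet fun j => chartFrame e c j z|⁻¹ * chartFrame e c j z α)) y
        (EuclideanSpace.single α 1) =
      (frameLineDeriv e P j (c.symm y) +
        P (c.symm y) * divCoeff e j (c.symm y)) * sqrtDetMetric g c y := by
  have hE : ∀ j, DifferentiableAt ℝ (chartFrame e c j) y := fun j =>
    (contDiffAt_chartFrame e hc hy j).differentiableAt (by simp)
  have hD := frameDet_chartFrame_ne_zero e hc hy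
  obtain ⟨hs, hdiv⟩ := sum_fderiv_inv_abs_frameDet_mul hE hD j
  have hPd : DifferentiableAt ℝ (P ∘ c.symm) y := by
    rw [← mdifferentiableAt_iff_differentiableAt]
    exact hP.comp y ((contMDiffAt_chart_symm hc hy).mdifferentiableAt (by simp))
  have hf : ∀ α, fderiv ℝ (fun z => P (c.symm z) *
        (|frameDet fun j => chartFrame e c j z|⁻¹ * chartFrame e c j z α)) y = _ := fun α =>
    (hPd.hasFDerivAt.mul (hs.hasFDerivAt.mul
      ((EuclideanSpace.proj α : E3 →L[ℝ] ℝ).hasFDerivAt.comp y (hE j).hasFDerivAt))).fderiv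
  have hPE := fderiv_comp_chart_symm e hc hy hP j
  rw [← hPE, divCoeff, sqrtDetMetric_eq e hc hy,
    EuclideanSpace.clm_apply_eq_sum (fderiv ℝ (P ∘ c.symm) y)]
  rw [EuclideanSpace.clm_apply_eq_sum] at hdiv
  simp only [bracketCoeff_mul_frameDet e hc hy, mul_div_assoc, div_self hD, mul_one] at hdiv
  simp only [hf]
  simp only [Fin.sum_univ_three] at hdiv ⊢
  simp
  linear_combination (P (c.symm y)) * hdiv

theorem integral_divergence_eq_zero [T2Space M] (e : OrthonormalFrame g)
    {c : OpenPartialHomeomorph M E3} (hc : c ∈ IsManifold.maximalAtlas 𝓘(ℝ, E3) ∞ M)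
    {P : M → ℝ} (hP : ContMDiff 𝓘(ℝ, E3) 𝓘(ℝ) 1 P) {K : Set M} (hK : IsCompact K)
    (hKc : K ⊆ c.source) (hPK : ∀ x ∉ K, P x = 0) (j : Fin 3) :
    ∫ y in c '' K, (frameLineDeriv e P j (c.symm y) +
        P (c.symm y) * divCoeff e j (c.symm y)) * sqrtDetMetric g c y = 0 := by
  have hcK : IsCompact (c '' K) := hK.image_of_continuousOn (c.continuousOn.mono hKc)
  have hcKt : c '' K ⊆ c.target := by
    rintro _ ⟨x, hx, rfl⟩
    exact c.map_source (hKc hx)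
  -- Nothing is known about `c.symm` off `c.target`, so the field is set to zero there. It remains
  -- `C¹`, because `P` vanishes off `K` and `c '' K` is a closed subset of the target.
  let h : Fin 3 → E3 → ℝ := fun α => c.target.indicator fun z => P (c.symm z) *
        (|frameDet fun j => chartFrame e c j z|⁻¹ * chartFrame e c j z α)
  have h0 : ∀ α, ∀ y ∉ c '' K, h α y = 0 := by
    intro α y hy
    by_cases hyt : y ∈ c.target
    · have : c.symm y ∉ K := fun hx => hy ⟨_, hx, c.right_inv hyt⟩
      simp [h, hPK _ this]
    · exact Set.indicator_of_notMem hyt _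
  have hz : ∀ α, ∀ y ∉ c '' K, h α =ᶠ[𝓝 y] fun _ => 0 := fun α y hy => by
    filter_upwards [hcK.isClosed.isOpen_compl.mem_nhds hy] with z hz using h0 α z hz
  have ht : ∀ α, ∀ y ∈ c.target, h α =ᶠ[𝓝 y] fun z => P (c.symm z) *
        (|frameDet fun j => chartFrame e c j z|⁻¹ * chartFrame e c j z α) := fun α y hy => by
    filter_upwards [c.open_target.mem_nhds hy] with z hz using Set.indicator_of_mem hz _
  have hsmooth : ∀ α, ContDiff ℝ 1 (h α) := fun α => contDiff_iff_contDiffAt.2 fun y => by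
    by_cases hy : y ∈ c '' K
    · have hyt := hcKt hy
      refine ContDiffAt.congr_of_eventuallyEq ?_ (ht α y hyt)
      have h1 : ContDiffAt ℝ 1 (P ∘ c.symm) y :=
        (hP.contMDiffAt.comp y ((contMDiffAt_chart_symm hc hyt).of_le (by simp))).contDiffAt
      have h2 : ContDiffAt ℝ ∞ (fun z => chartFrame e c j z α) y :=
        (EuclideanSpace.proj α : E3 →L[ℝ] ℝ).contDiff.contDiffAt.comp y
          (contDiffAt_chartFrame e hc hyt j)
      exact h1.mul (((contDiffAt_frameDet_chartFrame e hc hyt).mul h2).of_le (by simp))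
    · exact contDiffAt_const.congr_of_eventuallyEq (hz α y hy)
  have hint := fun α => integral_fderiv_apply_eq_zero (μ := volume) (hsmooth α)
    (HasCompactSupport.intro hcK (h0 α)) (EuclideanSpace.single α 1)
  have hsum : ∫ y, ∑ α, fderiv ℝ (h α) y (EuclideanSpace.single α 1) = 0 := by
    rw [integral_finsetSum _ fun α _ => (hint α).1]
    exact Finset.sum_eq_zero fun α _ => (hint α).2
  rw [← setIntegral_eq_integral_of_forall_compl_eq_zero (s := c '' K)] at hsum
  · rw [← hsum]
    refine setIntegral_congr_fun hcK.measurableSet fun y hy => ?_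
    have hyt := hcKt hy
    rw [← sum_fderiv_chart_divergence e hc hyt (hP.mdifferentiableAt (by simp))]
    exact Finset.sum_congr rfl fun α _ => by rw [(ht α y hyt).fderiv_eq]
  · intro y hy
    exact Finset.sum_eq_zero fun α _ => by rw [(hz α y hy).fderiv_eq]; simp

end Divergence

/-! ### Algebra of the Pauli matrices. -/

section SpinorAlgebra

/-- The real bilinear form `(a, b) ↦ Re (ā A b)` on spinors. -/
noncomputable def spinorForm (A : Matrix (Fin 2) (Fin 2) ℂ) : Spinor →L[ℝ] Spinor →L[ℝ] ℝ :=
  LinearMap.toContinuousBilinearMap (LinearMap.mk₂ ℝ (fun a b : Spinor => (star a ⬝ᵥ (A *ᵥ b)).re)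
    (fun a a' b => by simp [add_dotProduct]) (fun r a b => by simp [smul_dotProduct]; ring)
    (fun a b b' => by simp [Matrix.mulVec_add]; ring)
    (fun r a b => by simp [Matrix.mulVec_smul]; ring))

theorem spinorForm_apply (A : Matrix (Fin 2) (Fin 2) ℂ) (a b : Spinor) :
    spinorForm A a b = (star a ⬝ᵥ (A *ᵥ b)).re := rfl

theorem spinorForm_one_mulVec (A : Matrix (Fin 2) (Fin 2) ℂ) (a b : Spinor) :
    spinorForm 1 a (A *ᵥ b) = spinorForm A a b := by
  simp [spinorForm_apply]

theorem spinorForm_ofReal_smul (A : Matrix (Fin 2) (Fin 2) ℂ) (r : ℝ) (a b : Spinor) :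
    spinorForm A a ((r : ℂ) • b) = r * spinorForm A a b := by
  rw [Complex.coe_smul, map_smul, smul_eq_mul]

theorem spinorForm_one_symm (a b : Spinor) : spinorForm 1 a b = spinorForm 1 b a := by
  simp [spinorForm_apply, dotProduct, Fin.sum_univ_two]
  ring

theorem spinorForm_one_self_pos {a : Spinor} (ha : a ≠ 0) : 0 < spinorForm 1 a a := by
  have h : spinorForm 1 a a = Complex.normSq (a 0) + Complex.normSq (a 1) := by
    simp [spinorForm_apply, dotProduct, Fin.sum_univ_two, Complex.normSq_apply]
  rw [h]
  by_cases h0 : a 0 = 0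
  · have h1 : a 1 ≠ 0 := fun h1 => ha (by ext i; fin_cases i <;> simp [h0, h1])
    have := Complex.normSq_pos.2 h1
    have := Complex.normSq_nonneg (a 0)
    linarith
  · have := Complex.normSq_pos.2 h0
    have := Complex.normSq_nonneg (a 1)
    linarith

/-- Pauli matrices are Hermitian, so `i s_j` is skew-Hermitian and its real form is antisymmetric.
-/
theorem spinorForm_pauli_antisymm (j : Fin 3) (a b : Spinor) :
    spinorForm (Complex.I • pauli j) a b = -spinorForm (Complex.I • pauli j) b a := by
  fin_cases j <;>
    simp [spinorForm_apply, dotProduct, Fin.sum_univ_two, Matrix.mulVec, pauli] <;> ring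

theorem spinorForm_pauli_self (j : Fin 3) (a : Spinor) :
    spinorForm (Complex.I • pauli j) a a = 0 := by
  linarith [spinorForm_pauli_antisymm j a a]

/-- The Weyl operator of a connection with coefficients `κ` in an orthonormal frame, `d j` being
the derivatives of the components of the spinor `s`. -/
theorem weyl_operator_eq {κ : Fin 3 → Fin 3 → Fin 3 → ℝ} (hκ : ∀ i j k, κ i k j = -κ i j k)
    (d : Fin 3 → Spinor) (s : Spinor) :
    Complex.I • ∑ j, pauli j *ᵥ (d j + (1 / 4 : ℂ) • ∑ i, ∑ k,
      (κ j i k : ℂ) • ((pauli k * pauli i) *ᵥ s)) =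
    ∑ j, (Complex.I • pauli j) *ᵥ d j +
      (1 / 2 : ℂ) • ∑ j, ((∑ k, κ k j k : ℝ) : ℂ) • ((Complex.I • pauli j) *ᵥ s) +
      (((κ 0 1 2 + κ 1 2 0 + κ 2 0 1) / 2 : ℝ) : ℂ) • s := by
  -- In `s_j s_k s_i` with `i ≠ k`, a repeated index reduces the product to a single Pauli matrix
  -- and produces the trace of `κ`; distinct indices give `±i` and produce the totally antisymmetric
  -- part. After this reduction to independent coefficients, the claim is checked by components.
  have h0 : ∀ i j, κ i j j = 0 := fun i j => by linarith [hκ i j j]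
  have h1 : ∀ i, κ i 1 0 = -κ i 0 1 := fun i => hκ i 0 1
  have h2 : ∀ i, κ i 2 0 = -κ i 0 2 := fun i => hκ i 0 2
  have h3 : ∀ i, κ i 2 1 = -κ i 1 2 := fun i => hκ i 1 2
  ext a
  fin_cases a <;>
  · simp [Fin.sum_univ_three, pauli, Fin.sum_univ_two, h0, h1, h2, h3,
      Matrix.mul_apply, Matrix.vecHead, Matrix.vecTail]
    ring_nf
    simp
    ring

end SpinorAlgebra

/-! ### The Weyl operator and the first variation. -/

section FirstVariation

theorem contMDiff_spinorForm {M : Type*} [TopologicalSpace M] [ChartedSpace E3 M]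
    (A : Matrix (Fin 2) (Fin 2) ℂ) {n : ℕ∞ω} {a b : M → Spinor}
    (ha : ContMDiff 𝓘(ℝ, E3) 𝓘(ℝ, Spinor) n a) (hb : ContMDiff 𝓘(ℝ, E3) 𝓘(ℝ, Spinor) n b) :
    ContMDiff 𝓘(ℝ, E3) 𝓘(ℝ) n (fun x => spinorForm A (a x) (b x)) :=
  ((spinorForm A).contDiff.contMDiff.comp ha).clm_apply hb

theorem spinorNorm_re {M : Type*} (η : M → Spinor) (x : M) :
    (spinorNorm η x).re = spinorForm 1 (η x) (η x) :=
  rfl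

theorem spinorNorm_add_smul_re {M : Type*} (η φ : M → Spinor) (x : M) (t : ℝ) :
    (spinorNorm (fun x => η x + (t : ℂ) • φ x) x).re =
      (spinorNorm η x).re + t * (2 * spinorForm 1 (φ x) (η x)) + t ^ 2 * (spinorNorm φ x).re := by
  simp only [Complex.coe_smul, spinorNorm_re,
    map_add, map_smul, add_apply, smul_apply, smul_eq_mul, spinorForm_one_symm (η x) (φ x)]
  ring

variable {M : Type*} [TopologicalSpace M] [ChartedSpace E3 M] [IsManifold 𝓘(ℝ, E3) ∞ M]
  {g : RiemMetric M}

/-- A curve through `x` with velocity `e_j`. -/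
noncomputable def frameCurve (e : OrthonormalFrame g) (j : Fin 3) (x : M) (t : ℝ) : M :=
  (chartAt E3 x).symm (chartAt E3 x x + t • chartFrame e (chartAt E3 x) j (chartAt E3 x x))

theorem frameCurve_zero (e : OrthonormalFrame g) (j : Fin 3) (x : M) : frameCurve e j x 0 = x := by
  simp [frameCurve]

/-- This reduces the sum and product rules for `frameLineDeriv` to calculus in one real variable. -/
theorem hasDerivAt_frameCurve (e : OrthonormalFrame g) (j : Fin 3) {x : M} {V : Type*}
    [NormedAddCommGroup V] [NormedSpace ℝ V] {f : M → V}
    (hf : MDifferentiableAt 𝓘(ℝ, E3) 𝓘(ℝ, V) f x) :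
    HasDerivAt (fun t => f (frameCurve e j x t)) (frameLineDeriv e f j x) 0 := by
  have hc := IsManifold.chart_mem_maximalAtlas (I := 𝓘(ℝ, E3)) (n := ∞) x
  have hy := mem_chart_target E3 x
  have hx : (chartAt E3 x).symm (chartAt E3 x x) = x := by simp
  have hf' : MDifferentiableAt 𝓘(ℝ, E3) 𝓘(ℝ, V) f ((chartAt E3 x).symm (chartAt E3 x x)) := by
    rwa [hx]
  have h := fderiv_comp_chart_symm e hc hy hf' j
  rw [hx] at h
  have hd : DifferentiableAt ℝ (f ∘ (chartAt E3 x).symm) (chartAt E3 x x) := by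
    rw [← mdifferentiableAt_iff_differentiableAt]
    exact hf'.comp _ ((contMDiffAt_chart_symm hc hy).mdifferentiableAt (by simp))
  rw [← h]
  exact hd.hasFDerivAt.hasLineDerivAt _

variable (e : OrthonormalFrame g)

theorem frameLineDeriv_add_smul {V : Type*} [NormedAddCommGroup V] [NormedSpace ℝ V]
    {f h : M → V} {x : M} (hf : MDifferentiableAt 𝓘(ℝ, E3) 𝓘(ℝ, V) f x)
    (hh : MDifferentiableAt 𝓘(ℝ, E3) 𝓘(ℝ, V) h x) (t : ℝ) (j : Fin 3) :
    frameLineDeriv e (fun x => f x + t • h x) j x =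
      frameLineDeriv e f j x + t • frameLineDeriv e h j x := by
  have h1 := hasDerivAt_frameCurve e j (hf.add (hh.const_smul t))
  exact h1.unique ((hasDerivAt_frameCurve e j hf).add ((hasDerivAt_frameCurve e j hh).const_smul t))

theorem frameLineDeriv_mul_spinorForm (A : Matrix (Fin 2) (Fin 2) ℂ) {u : M → ℝ} {a b : M → Spinor}
    {x : M} (hu : MDifferentiableAt 𝓘(ℝ, E3) 𝓘(ℝ) u x)
    (ha : MDifferentiableAt 𝓘(ℝ, E3) 𝓘(ℝ, Spinor) a x)
    (hb : MDifferentiableAt 𝓘(ℝ, E3) 𝓘(ℝ, Spinor) b x)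
    (hP : MDifferentiableAt 𝓘(ℝ, E3) 𝓘(ℝ) (fun x => u x * spinorForm A (a x) (b x)) x)
    (j : Fin 3) :
    frameLineDeriv e (fun x => u x * spinorForm A (a x) (b x)) j x =
      frameLineDeriv e u j x * spinorForm A (a x) (b x) +
      u x * (spinorForm A (frameLineDeriv e a j x) (b x) +
        spinorForm A (a x) (frameLineDeriv e b j x)) := by
  have h := (hasDerivAt_frameCurve e j hu).mul ((spinorForm A).hasDerivAt_of_bilinear
    (fun _ => hasDerivAt_frameCurve e j ha) (fun _ => hasDerivAt_frameCurve e j hb))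
  have := (hasDerivAt_frameCurve e j hP).unique h
  simp only [frameCurve_zero] at this
  rw [this]
  ring

/-- The totally antisymmetric part of the connection. -/
noncomputable def axialCoeff (x : M) : ℝ :=
  (connectionCoeff e 0 1 2 x + connectionCoeff e 1 2 0 x + connectionCoeff e 2 0 1 x) / 2

theorem contMDiff_divCoeff (j : Fin 3) : ContMDiff 𝓘(ℝ, E3) 𝓘(ℝ) ∞ (divCoeff e j) := by
  unfold divCoeff
  exact ContMDiff.sum fun k _ => contMDiff_bracketCoeff e k j k

theorem contMDiff_axialCoeff : ContMDiff 𝓘(ℝ, E3) 𝓘(ℝ) ∞ (axialCoeff e) := by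
  have h : ∀ i j k, ContMDiff 𝓘(ℝ, E3) 𝓘(ℝ) ∞ (connectionCoeff e i j k) := fun i j k =>
    (((contMDiff_bracketCoeff e i j k).sub (contMDiff_bracketCoeff e j k i)).add
      (contMDiff_bracketCoeff e k i j)).div_const 2
  exact (((h 0 1 2).add (h 1 2 0)).add (h 2 0 1)).div_const 2

/-- The Weyl operator `i σ^α ∇_α`. -/
noncomputable def weylOperator (η : M → Spinor) (x : M) : Spinor :=
  Complex.I • ∑ j, pauli j *ᵥ spinorDeriv e η j x

/-- The trace of the connection is the divergence of the frame, by contraction of the Koszul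
formula. -/
theorem weylOperator_eq (η : M → Spinor) (x : M) :
    weylOperator e η x = ∑ j, (Complex.I • pauli j) *ᵥ frameLineDeriv e η j x +
      (1 / 2 : ℂ) • ∑ j, (divCoeff e j x : ℂ) • ((Complex.I • pauli j) *ᵥ η x) +
      (axialCoeff e x : ℂ) • η x := by
  have hdiv : ∀ j, divCoeff e j x = ∑ k, connectionCoeff e k j k x := fun j =>
    Finset.sum_congr rfl fun k _ => by
      unfold connectionCoeff
      have := bracketCoeff_swap e k j k x
      have := bracketCoeff_swap e k k j x
      linarith
  simp only [hdiv]
  exact weyl_operator_eq (fun i j k => connectionCoeff_antisymm e i j k x) _ _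

theorem spinorForm_one_weylOperator (η : M → Spinor) (x : M) (a : Spinor) :
    spinorForm 1 a (weylOperator e η x) =
      ∑ j, spinorForm (Complex.I • pauli j) a (frameLineDeriv e η j x) +
      (1 / 2) * ∑ j, divCoeff e j x * spinorForm (Complex.I • pauli j) a (η x) +
      axialCoeff e x * spinorForm 1 a (η x) := by
  have h : (1 / 2 : ℂ) = ((1 / 2 : ℝ) : ℂ) := by norm_num
  simp only [weylOperator_eq, h, map_add, map_sum, spinorForm_ofReal_smul, spinorForm_one_mulVec]

theorem weylForm_re_eq_weylOperator (η : M → Spinor) (x : M) :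
    (weylForm e η x).re = spinorForm 1 (η x) (weylOperator e η x) := by
  unfold weylForm weylOperator
  generalize spinorDeriv e η = d
  simp [spinorForm_apply, pauli, Fin.sum_univ_three, dotProduct, Fin.sum_univ_two, Matrix.vecHead,
    Matrix.vecTail]
  ring

/-- The divergence terms of the Weyl operator drop out by antisymmetry of the real form of `i s_j`.
-/
theorem weylForm_re (η : M → Spinor) (x : M) :
    (weylForm e η x).re = ∑ j, spinorForm (Complex.I • pauli j) (η x) (frameLineDeriv e η j x) +
      axialCoeff e x * spinorForm 1 (η x) (η x) := by
  simp [weylForm_re_eq_weylOperator, spinorForm_one_weylOperator, spinorForm_pauli_self]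

theorem solvesWeyl_iff (p : ℝ) (η : M → Spinor) :
    SolvesWeyl e p η ↔ ∀ x, weylOperator e η x = (p : ℂ) • η x := by
  refine forall_congr' fun x => ?_
  rw [sigmaUpperZero, Matrix.neg_mulVec, Matrix.one_mulVec, smul_neg, neg_add_eq_zero, eq_comm]
  rfl

/-- The quotient `u` of the real scalars `(i/2) (η̄ σ^α ∇_α η - η σ^α ∇_α η̄)` and `η̄ σ_0 η`. -/
noncomputable def weylRatio (η : M → Spinor) (x : M) : ℝ :=
  (weylForm e η x).re / (spinorNorm η x).re

theorem contMDiff_weylForm_re {m n : ℕ∞} {η : M → Spinor}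
    (hη : ContMDiff 𝓘(ℝ, E3) 𝓘(ℝ, Spinor) n η) (hmn : m + 1 ≤ n) :
    ContMDiff 𝓘(ℝ, E3) 𝓘(ℝ) m (fun x => (weylForm e η x).re) := by
  have hηm : ContMDiff 𝓘(ℝ, E3) 𝓘(ℝ, Spinor) m η :=
    hη.of_le (by exact_mod_cast le_self_add.trans hmn)
  simp only [weylForm_re]
  exact (ContMDiff.sum fun j _ => contMDiff_spinorForm _ hηm
    (contMDiff_frameLineDeriv e hη hmn j)).add
    (((contMDiff_axialCoeff e).of_le (by exact_mod_cast le_top)).mul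
      (contMDiff_spinorForm _ hηm hηm))

theorem contMDiff_weylRatio {m n : ℕ∞} {η : M → Spinor}
    (hη : ContMDiff 𝓘(ℝ, E3) 𝓘(ℝ, Spinor) n η) (hmn : m + 1 ≤ n) (hη0 : ∀ x, η x ≠ 0) :
    ContMDiff 𝓘(ℝ, E3) 𝓘(ℝ) m (weylRatio e η) := by
  have hηm : ContMDiff 𝓘(ℝ, E3) 𝓘(ℝ, Spinor) m η :=
    hη.of_le (by exact_mod_cast le_self_add.trans hmn)
  exact (contMDiff_weylForm_re e hη hmn).div₀ (contMDiff_spinorForm 1 hηm hηm)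
    fun x => (spinorForm_one_self_pos (hη0 x)).ne'

/-- The left-hand side `i σ^α (∂_α u) η + 2 u i σ^α ∇_α η - (u² + p₀²) η` of the Euler–Lagrange
equation of the stationary Lagrangian. -/
noncomputable def eulerLagrange (p₀ : ℝ) (η : M → Spinor) (x : M) : Spinor :=
  ∑ j, ((frameLineDeriv e (weylRatio e η) j x : ℝ) : ℂ) • ((Complex.I • pauli j) *ᵥ η x) +
    ((2 * weylRatio e η x : ℝ) : ℂ) • weylOperator e η x -
    ((weylRatio e η x ^ 2 + p₀ ^ 2 : ℝ) : ℂ) • η x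

theorem spinorForm_one_eulerLagrange (p₀ : ℝ) (η : M → Spinor) (x : M) (a : Spinor) :
    spinorForm 1 a (eulerLagrange e p₀ η x) =
      ∑ j, frameLineDeriv e (weylRatio e η) j x * spinorForm (Complex.I • pauli j) a (η x) +
        2 * weylRatio e η x * spinorForm 1 a (weylOperator e η x) -
        (weylRatio e η x ^ 2 + p₀ ^ 2) * spinorForm 1 a (η x) := by
  simp only [eulerLagrange, map_add, map_sub, map_sum, spinorForm_ofReal_smul,
    spinorForm_one_mulVec]

theorem continuous_spinorForm_one_eulerLagrange (p₀ : ℝ) {η φ : M → Spinor}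
    (hη : ContMDiff 𝓘(ℝ, E3) 𝓘(ℝ, Spinor) 2 η) (hη0 : ∀ x, η x ≠ 0) (hφ : Continuous φ) :
    Continuous fun x => spinorForm 1 (φ x) (eulerLagrange e p₀ η x) := by
  have hu : ContMDiff 𝓘(ℝ, E3) 𝓘(ℝ) 1 (weylRatio e η) :=
    contMDiff_weylRatio e (m := 1) (n := 2) hη (by norm_num) hη0
  have hdu := fun j => (contMDiff_frameLineDeriv e (m := 0) (n := 1) hu (by simp) j).continuous
  have hdη := fun j => (contMDiff_frameLineDeriv e (m := 1) (n := 2) hη (by norm_num) j).continuous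
  have hdiv := fun j => (contMDiff_divCoeff e j).continuous
  have hax := (contMDiff_axialCoeff e).continuous
  have := hu.continuous
  have := hη.continuous
  simp only [spinorForm_one_eulerLagrange, spinorForm_one_weylOperator]
  fun_prop

/-- The first variation of `(i/2) (η̄ σ^α ∇_α η - η σ^α ∇_α η̄)` at `η` in the direction `φ`. -/
noncomputable def weylFormVariation (η φ : M → Spinor) (x : M) : ℝ :=
  ∑ j, (spinorForm (Complex.I • pauli j) (η x) (frameLineDeriv e φ j x) +
    spinorForm (Complex.I • pauli j) (φ x) (frameLineDeriv e η j x)) +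
    2 * axialCoeff e x * spinorForm 1 (φ x) (η x)

theorem weylForm_add_smul_re {η φ : M → Spinor} {x : M}
    (hη : MDifferentiableAt 𝓘(ℝ, E3) 𝓘(ℝ, Spinor) η x)
    (hφ : MDifferentiableAt 𝓘(ℝ, E3) 𝓘(ℝ, Spinor) φ x) (t : ℝ) :
    (weylForm e (fun x => η x + (t : ℂ) • φ x) x).re =
      (weylForm e η x).re + t * weylFormVariation e η φ x + t ^ 2 * (weylForm e φ x).re := by
  simp only [Complex.coe_smul, weylForm_re, frameLineDeriv_add_smul e hη hφ, weylFormVariation,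
    map_add, map_smul, add_apply, smul_apply, smul_eq_mul, Fin.sum_univ_three,
    spinorForm_one_symm (η x) (φ x)]
  ring

/-- The first variation of the Lagrangian is the pairing of the variation with the Euler–Lagrange
expression, up to a divergence. -/
theorem lagrangian_variation_eq (p₀ : ℝ) {η φ : M → Spinor}
    (hη : ContMDiff 𝓘(ℝ, E3) 𝓘(ℝ, Spinor) 2 η) (hη0 : ∀ x, η x ≠ 0)
    (hφ : ContMDiff 𝓘(ℝ, E3) 𝓘(ℝ, Spinor) 1 φ) (x : M) :
    2 * weylRatio e η x * weylFormVariation e η φ x -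
        (weylRatio e η x ^ 2 + p₀ ^ 2) * (2 * spinorForm 1 (φ x) (η x)) =
      2 * spinorForm 1 (φ x) (eulerLagrange e p₀ η x) +
      2 * ∑ j, (frameLineDeriv e
          (fun x => weylRatio e η x * spinorForm (Complex.I • pauli j) (η x) (φ x)) j x +
        weylRatio e η x * spinorForm (Complex.I • pauli j) (η x) (φ x) * divCoeff e j x) := by
  have hu : ContMDiff 𝓘(ℝ, E3) 𝓘(ℝ) 1 (weylRatio e η) :=
    contMDiff_weylRatio e (m := 1) (n := 2) hη (by norm_num) hη0
  have hη1 : ContMDiff 𝓘(ℝ, E3) 𝓘(ℝ, Spinor) 1 η := hη.of_le (by norm_num)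
  have hP := fun j => frameLineDeriv_mul_spinorForm e (Complex.I • pauli j)
    (hu.mdifferentiableAt one_ne_zero) (hη1.mdifferentiableAt one_ne_zero)
    (hφ.mdifferentiableAt one_ne_zero)
    ((hu.mul (contMDiff_spinorForm (Complex.I • pauli j) hη1 hφ)).mdifferentiableAt one_ne_zero
      (x := x)) j
  -- Antisymmetry moves `φ` to the second slot. The terms in `∂u` then cancel, and the half
  -- divergence inside the Weyl operator cancels the `divCoeff` terms.
  simp only [hP, spinorForm_one_eulerLagrange, spinorForm_one_weylOperator, weylFormVariation,
    Fin.sum_univ_three, fun j => spinorForm_pauli_antisymm j (φ x) (η x),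
    fun j => spinorForm_pauli_antisymm j (φ x) (frameLineDeriv e η j x)]
  ring

end FirstVariation

/-! ### From the action to the Euler–Lagrange equation. -/

section FieldEquation

/-- Along `η + tφ` both real scalars are quadratic in `t`, and `a²/r - p² r` has derivative `2 (a/r)
a' - ((a/r)² + p²) r'`. -/
theorem hasDerivAt_setIntegral_quotient {E : Type*} [TopologicalSpace E] [T2Space E]
    [MeasurableSpace E] [OpensMeasurableSpace E] {μ : Measure E} [IsFiniteMeasureOnCompacts μ]
    {K : Set E} (hK : IsCompact K) {a₀ a₁ a₂ r₀ r₁ r₂ s : E → ℝ} (p : ℝ) (ha₀ : ContinuousOn a₀ K)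
    (ha₁ : ContinuousOn a₁ K) (ha₂ : ContinuousOn a₂ K) (hr₀ : ContinuousOn r₀ K)
    (hr₁ : ContinuousOn r₁ K) (hr₂ : ContinuousOn r₂ K) (hs : ContinuousOn s K)
    (h0 : ∀ y ∈ K, r₀ y ≠ 0) :
    HasDerivAt (fun t : ℝ => ∫ y in K, 16 / (9 * (r₀ y + t * r₁ y + t ^ 2 * r₂ y)) *
        ((a₀ y + t * a₁ y + t ^ 2 * a₂ y) ^ 2 - (p * (r₀ y + t * r₁ y + t ^ 2 * r₂ y)) ^ 2) * s y ∂μ)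
      (∫ y in K, 16 / 9 * (2 * (a₀ y / r₀ y) * a₁ y - ((a₀ y / r₀ y) ^ 2 + p ^ 2) * r₁ y) * s y ∂μ)
      0 := by
  -- By compactness of `K`, the denominator stays nonzero on all of `K` for every small `t`.
  have hev : ∀ᶠ t : ℝ in 𝓝 0, ∀ y ∈ K, r₀ y + t * r₁ y + t ^ 2 * r₂ y ≠ 0 := by
    have := isCompact_iff_compactSpace.1 hK
    have hr : Continuous fun z : ℝ × K => r₀ z.2 + z.1 * r₁ z.2 + z.1 ^ 2 * r₂ z.2 := by
      have h₀ := hr₀.domRestrict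
      have h₁ := hr₁.domRestrict
      have h₂ := hr₂.domRestrict
      exact ((h₀.comp continuous_snd).add (continuous_fst.mul (h₁.comp continuous_snd))).add
        ((continuous_fst.pow 2).mul (h₂.comp continuous_snd))
    have := isCompact_univ.eventually_forall_of_forall_eventually (x₀ := (0 : ℝ))
      (P := fun (t : ℝ) (y : K) => r₀ y + t * r₁ y + t ^ 2 * r₂ y ≠ 0) (K := Set.univ)
      fun y _ => hr.continuousAt.eventually_ne (by simpa using h0 y y.2)
    filter_upwards [this] with t ht y hy using ht ⟨y, hy⟩ trivial
  obtain ⟨ε, hε, hball⟩ := Metric.eventually_nhds_iff.1 hev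
  have hne : ∀ t ∈ Set.Icc (-(ε / 2)) (ε / 2), ∀ y ∈ K, r₀ y + t * r₁ y + t ^ 2 * r₂ y ≠ 0 :=
    fun t ht => hball (by
      rw [Real.dist_0_eq_abs]
      exact (abs_le.2 ht).trans_lt (by linarith))
  have key := hasDerivAt_setIntegral_of_continuousOn (μ := μ) hK (ε := ε / 2)
    (F := fun t y => 16 / (9 * (r₀ y + t * r₁ y + t ^ 2 * r₂ y)) *
        ((a₀ y + t * a₁ y + t ^ 2 * a₂ y) ^ 2 - (p * (r₀ y + t * r₁ y + t ^ 2 * r₂ y)) ^ 2) * s y)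
    (F' := fun t y => 16 / 9 * (2 * ((a₀ y + t * a₁ y + t ^ 2 * a₂ y) /
      (r₀ y + t * r₁ y + t ^ 2 * r₂ y)) * (a₁ y + 2 * t * a₂ y) -
      (((a₀ y + t * a₁ y + t ^ 2 * a₂ y) / (r₀ y + t * r₁ y + t ^ 2 * r₂ y)) ^ 2 + p ^ 2) *
        (r₁ y + 2 * t * r₂ y)) * s y) (by positivity) ?_ ?_ ?_
  · simpa using key
  · intro t ht
    have hA : ContinuousOn (fun y => a₀ y + t * a₁ y + t ^ 2 * a₂ y) K := by fun_prop
    have hR : ContinuousOn (fun y => r₀ y + t * r₁ y + t ^ 2 * r₂ y) K := by fun_prop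
    exact ((continuousOn_const.div (continuousOn_const.mul hR) fun y hy =>
      mul_ne_zero (by norm_num) (hne t ht y hy)).mul ((hA.pow 2).sub
        ((continuousOn_const.mul hR).pow 2))).mul hs
  · have hc : ∀ {f : E → ℝ}, ContinuousOn f K → ContinuousOn (fun z : ℝ × E => f z.2)
        (Set.Icc (-(ε / 2)) (ε / 2) ×ˢ K) := fun hf => hf.comp continuousOn_snd fun z hz => hz.2
    have hq : ∀ {b₀ b₁ b₂ : E → ℝ}, ContinuousOn b₀ K → ContinuousOn b₁ K → ContinuousOn b₂ K →
        ContinuousOn (fun z : ℝ × E => b₀ z.2 + z.1 * b₁ z.2 + z.1 ^ 2 * b₂ z.2)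
          (Set.Icc (-(ε / 2)) (ε / 2) ×ˢ K) := fun h₀ h₁ h₂ =>
      ((hc h₀).add (continuousOn_fst.mul (hc h₁))).add ((continuousOn_fst.pow 2).mul (hc h₂))
    have hl : ∀ {b₁ b₂ : E → ℝ}, ContinuousOn b₁ K → ContinuousOn b₂ K →
        ContinuousOn (fun z : ℝ × E => b₁ z.2 + 2 * z.1 * b₂ z.2)
          (Set.Icc (-(ε / 2)) (ε / 2) ×ˢ K) := fun h₁ h₂ =>
      (hc h₁).add ((continuousOn_const.mul continuousOn_fst).mul (hc h₂))
    have hu := (hq ha₀ ha₁ ha₂).div (hq hr₀ hr₁ hr₂) fun z hz => hne z.1 hz.1 z.2 hz.2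
    exact (continuousOn_const.mul (((continuousOn_const.mul hu).mul (hl ha₁ ha₂)).sub
      (((hu.pow 2).add continuousOn_const).mul (hl hr₁ hr₂)))).mul (hc hs)
  · intro t ht y hy
    have hr := hne t ht y hy
    have hq : ∀ b₀ b₁ b₂ : ℝ,
        HasDerivAt (fun t => b₀ + t * b₁ + t ^ 2 * b₂) (b₁ + 2 * t * b₂) t := by
      intro b₀ b₁ b₂
      exact ((((hasDerivAt_id t).mul_const b₁).const_add b₀).add
        (((hasDerivAt_id t).pow 2).mul_const b₂)).congr_deriv (by simp)
    have hA := hq (a₀ y) (a₁ y) (a₂ y)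
    have hR := hq (r₀ y) (r₁ y) (r₂ y)
    have := (((hasDerivAt_const t (16 : ℝ)).div (hR.const_mul 9)
      (mul_ne_zero (by norm_num) hr)).mul ((hA.pow 2).sub ((hR.const_mul p).pow 2))).mul_const (s y)
    refine this.congr_deriv ?_
    dsimp only [Pi.pow_apply, Pi.sub_apply, Pi.div_apply]
    field_simp
    ring

variable {M : Type*} [TopologicalSpace M] [ChartedSpace E3 M]
  [IsManifold 𝓘(ℝ, E3) ∞ M] {g : RiemMetric M} (e : OrthonormalFrame g)

theorem weylRatio_eq_of_solvesWeyl {p : ℝ} {η : M → Spinor} (hη0 : ∀ x, η x ≠ 0)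
    (h : SolvesWeyl e p η) (x : M) : weylRatio e η x = p := by
  rw [weylRatio, weylForm_re_eq_weylOperator, (solvesWeyl_iff e p η).1 h, spinorForm_ofReal_smul,
    spinorNorm_re, mul_div_cancel_right₀ _ (spinorForm_one_self_pos (hη0 x)).ne']

theorem frameLineDeriv_const {V : Type*} [NormedAddCommGroup V] [NormedSpace ℝ V] (v : V)
    (j : Fin 3) (x : M) : frameLineDeriv e (fun _ => v) j x = 0 := by
  rw [frameLineDeriv, mfderiv_const]
  rfl

variable [T2Space M]

/-- The divergence part of the variation integrates to zero. The constant is `32/9 = 2 · 16/9`, the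
`2` coming from the quadratic dependence on the spinor. -/
theorem hasDerivAt_action (p₀ : ℝ) {η φ : M → Spinor}
    (hη : ContMDiff 𝓘(ℝ, E3) 𝓘(ℝ, Spinor) 2 η) (hη0 : ∀ x, η x ≠ 0)
    (hφ : ContMDiff 𝓘(ℝ, E3) 𝓘(ℝ, Spinor) ∞ φ) {c : OpenPartialHomeomorph M E3}
    (hc : c ∈ IsManifold.maximalAtlas 𝓘(ℝ, E3) ∞ M) (hφc : HasCompactSupport φ)
    (hφs : tsupport φ ⊆ c.source) :
    HasDerivAt (fun t : ℝ => ∫ y in c '' tsupport φ,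
        stationaryLagrangian e p₀ (fun x => η x + (t : ℂ) • φ x) c y)
      (∫ y in c '' tsupport φ, 32 / 9 * spinorForm 1 (φ (c.symm y))
        (eulerLagrange e p₀ η (c.symm y)) * sqrtDetMetric g c y) 0 := by
  have hφ1 : ContMDiff 𝓘(ℝ, E3) 𝓘(ℝ, Spinor) 1 φ := hφ.of_le (by simp)
  have hη1 : ContMDiff 𝓘(ℝ, E3) 𝓘(ℝ, Spinor) 1 η := hη.of_le (by norm_num)
  have hK : IsCompact (c '' tsupport φ) :=
    hφc.isCompact.image_of_continuousOn (c.continuousOn.mono hφs)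
  have hKt : c '' tsupport φ ⊆ c.target := by
    rintro _ ⟨x, hx, rfl⟩
    exact c.map_source (hφs hx)
  have hcont : ∀ {f : M → ℝ}, Continuous f →
      ContinuousOn (fun y => f (c.symm y)) (c '' tsupport φ) :=
    fun hf => hf.comp_continuousOn (c.continuousOn_symm.mono hKt)
  have hs : ContinuousOn (sqrtDetMetric g c) (c '' tsupport φ) := fun y hy =>
    (continuousAt_sqrtDetMetric e hc (hKt hy)).continuousWithinAt
  have hdη := fun j => (contMDiff_frameLineDeriv e (m := 0) (n := 1) hη1 (by simp) j).continuous
  have hdφ := fun j => (contMDiff_frameLineDeriv e (m := 0) (n := 1) hφ1 (by simp) j).continuous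
  have hvar : Continuous (weylFormVariation e η φ) := by
    have := (contMDiff_axialCoeff e).continuous
    have := hη1.continuous
    have := hφ1.continuous
    unfold weylFormVariation
    fun_prop
  have hder := hasDerivAt_setIntegral_quotient (μ := volume) hK p₀
    (hcont (contMDiff_weylForm_re e (m := 0) (n := 1) hη1 (by simp)).continuous) (hcont hvar)
    (hcont (contMDiff_weylForm_re e (m := 0) (n := 1) hφ1 (by simp)).continuous)
    (hcont (contMDiff_spinorForm 1 hη1 hη1).continuous)
    (hcont ((contMDiff_spinorForm 1 hφ1 hη1).continuous.const_mul 2))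
    (hcont (contMDiff_spinorForm 1 hφ1 hφ1).continuous) hs
    (fun y _ => (spinorForm_one_self_pos (hη0 _)).ne')
  refine (hder.congr_deriv ?_).congr_of_eventuallyEq (.of_forall fun t => ?_)
  · have hP : ∀ j, ContMDiff 𝓘(ℝ, E3) 𝓘(ℝ) 1 fun x =>
        weylRatio e η x * spinorForm (Complex.I • pauli j) (η x) (φ x) := fun j =>
      (contMDiff_weylRatio e (m := 1) (n := 2) hη (by norm_num) hη0).mul
        (contMDiff_spinorForm (Complex.I • pauli j) hη1 hφ1)
    have hdiv := fun j => integral_divergence_eq_zero e hc (hP j) hφc.isCompact hφs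
      (fun x hx => by simp [image_eq_zero_of_notMem_tsupport hx]) j
    have hint : ∀ j, IntegrableOn (fun y => (frameLineDeriv e (fun x => weylRatio e η x *
        spinorForm (Complex.I • pauli j) (η x) (φ x)) j (c.symm y) + weylRatio e η (c.symm y) *
        spinorForm (Complex.I • pauli j) (η (c.symm y)) (φ (c.symm y)) *
          divCoeff e j (c.symm y)) * sqrtDetMetric g c y) (c '' tsupport φ) := fun j =>
      (((hcont (contMDiff_frameLineDeriv e (m := 0) (n := 1) (hP j) (by simp) j).continuous).add
        ((hcont (hP j).continuous).mul (hcont (contMDiff_divCoeff e j).continuous))).mul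
        hs).integrableOn_compact hK
    have hintF : IntegrableOn (fun y => 32 / 9 * spinorForm 1 (φ (c.symm y))
        (eulerLagrange e p₀ η (c.symm y)) * sqrtDetMetric g c y) (c '' tsupport φ) :=
      ((continuousOn_const.mul (hcont (continuous_spinorForm_one_eulerLagrange e p₀ hη hη0
        hφ1.continuous))).mul hs).integrableOn_compact hK
    -- Adding divergences of zero integral lets the two integrands be compared pointwise.
    have hsum := integral_add hintF
      ((integrable_finsetSum Finset.univ fun j _ => hint j).const_mul (32 / 9))
    rw [integral_const_mul, integral_finsetSum _ fun j _ => hint j,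
      Finset.sum_eq_zero fun j _ => hdiv j, mul_zero, add_zero] at hsum
    rw [← hsum]
    refine setIntegral_congr_fun hK.measurableSet fun y _ => ?_
    have := lagrangian_variation_eq e p₀ hη hη0 hφ1 (c.symm y)
    simp only [weylRatio, spinorNorm_re] at this
    simp only [← Finset.sum_mul, this, weylRatio, spinorNorm_re]
    ring
  · refine setIntegral_congr_fun hK.measurableSet fun y hy => ?_
    simp only [stationaryLagrangian, spinorNorm_add_smul_re,
      weylForm_add_smul_re e (hη1.mdifferentiableAt one_ne_zero)
        (hφ1.mdifferentiableAt one_ne_zero)]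
    rfl

/-- The fundamental lemma of the calculus of variations: if the expression has a nonzero value `v`
at `x₀`, the variation `f v`, with a bump function `f` at `x₀`, has positive first variation. -/
theorem solvesFieldEquation_iff_eulerLagrange (p₀ : ℝ) {η : M → Spinor}
    (hη : ContMDiff 𝓘(ℝ, E3) 𝓘(ℝ, Spinor) 2 η) (hη0 : ∀ x, η x ≠ 0) :
    SolvesFieldEquation e p₀ η ↔ ∀ x, eulerLagrange e p₀ η x = 0 := by
  refine ⟨fun h x₀ => ?_, fun h c hc φ hφ hφc hφs => ?_⟩
  · by_contra hv
    set v := eulerLagrange e p₀ η x₀ with hvdef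
    have hw : Continuous fun x => spinorForm 1 v (eulerLagrange e p₀ η x) :=
      continuous_spinorForm_one_eulerLagrange e p₀ (φ := fun _ => v) hη hη0 continuous_const
    have hU : {x | 0 < spinorForm 1 v (eulerLagrange e p₀ η x)} ∈ 𝓝 x₀ :=
      (isOpen_lt continuous_const hw).mem_nhds (spinorForm_one_self_pos hv)
    obtain ⟨f, -, hfU⟩ := (SmoothBumpFunction.nhds_basis_tsupport (I := 𝓘(ℝ, E3)) x₀).mem_iff.1 hU
    set c := chartAt E3 x₀
    have hc : c ∈ IsManifold.maximalAtlas 𝓘(ℝ, E3) ∞ M := IsManifold.chart_mem_maximalAtlas x₀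
    have hφ : ContMDiff 𝓘(ℝ, E3) 𝓘(ℝ, Spinor) ∞ fun x => f x • v := f.contMDiff.smul contMDiff_const
    have hts : tsupport (fun x => f x • v) ⊆ tsupport f := tsupport_smul_subset_left _ _
    have hφc : HasCompactSupport fun x => f x • v := f.hasCompactSupport.smul_right
    have hφs : tsupport (fun x => f x • v) ⊆ c.source := hts.trans f.tsupport_subset_chartAt_source
    have h0 := (hasDerivAt_action e p₀ hη hη0 hφ hc hφc hφs).unique (h c hc _ hφ hφc hφs)
    have hK : IsCompact (c '' tsupport fun x => f x • v) :=
      hφc.isCompact.image_of_continuousOn (c.continuousOn.mono hφs)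
    have hKt : ∀ y ∈ c '' tsupport fun x => f x • v, y ∈ c.target ∧ c.symm y ∈ tsupport f := by
      rintro _ ⟨x, hx, rfl⟩
      exact ⟨c.map_source (hφs hx), by rw [c.left_inv (hφs hx)]; exact hts hx⟩
    have hs0 : ∀ y ∈ c.target, 0 < sqrtDetMetric g c y := fun y hy => by
      rw [sqrtDetMetric_eq e hc hy]
      exact inv_pos.2 (abs_pos.2 (frameDet_chartFrame_ne_zero e hc hy))
    have hF : ∀ y, 32 / 9 * spinorForm 1 (f (c.symm y) • v) (eulerLagrange e p₀ η (c.symm y)) *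
        sqrtDetMetric g c y = 32 / 9 * (f (c.symm y) *
          spinorForm 1 v (eulerLagrange e p₀ η (c.symm y))) * sqrtDetMetric g c y := fun y => by
      rw [map_smul, smul_apply, smul_eq_mul]
    have hs : ContinuousOn (sqrtDetMetric g c) (c '' tsupport fun x => f x • v) := fun y hy =>
      (continuousAt_sqrtDetMetric e hc (hKt y hy).1).continuousWithinAt
    have hcs : ContinuousOn c.symm (c '' tsupport fun x => f x • v) :=
      c.continuousOn_symm.mono fun y hy => (hKt y hy).1
    have hpos := setIntegral_pos_iff_support_of_nonneg_ae (μ := volume)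
      (f := fun y => 32 / 9 * (f (c.symm y) * spinorForm 1 v (eulerLagrange e p₀ η (c.symm y))) *
        sqrtDetMetric g c y) (s := c '' tsupport fun x => f x • v)
      ((ae_restrict_iff' hK.measurableSet).2 (ae_of_all _ fun y hy =>
        mul_nonneg (mul_nonneg (by norm_num) (mul_nonneg f.nonneg (hfU (hKt y hy).2).le))
          (hs0 y (hKt y hy).1).le))
      (((continuousOn_const.mul ((f.continuous.comp_continuousOn hcs).mul
        (hw.comp_continuousOn hcs))).mul hs).integrableOn_compact hK)
    simp only [hF] at h0
    rw [h0] at hpos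
    refine (lt_irrefl (0 : ℝ)) (hpos.2 ?_)
    -- The integrand is strictly positive on this nonempty open set, which has positive Lebesgue
    -- measure.
    have hopen : IsOpen (c.target ∩ c.symm ⁻¹' Function.support f) :=
      c.isOpen_inter_preimage_symm f.isOpen_support
    refine (hopen.measure_pos volume ⟨c x₀, mem_chart_target E3 x₀, ?_⟩).trans_le
      (measure_mono fun y hy => ⟨?_, ?_⟩)
    · rw [Set.mem_preimage, c.left_inv (mem_chart_source E3 x₀)]
      exact f.c_mem_support
    · exact mul_ne_zero (mul_ne_zero (by norm_num) (mul_ne_zero hy.2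
        (hfU (subset_tsupport _ hy.2)).ne')) (hs0 y hy.1).ne'
    · exact ⟨c.symm y, subset_tsupport _ (smul_ne_zero hy.2 hv), c.right_inv hy.1⟩
  · have := hasDerivAt_action e p₀ hη hη0 hφ hc hφc hφs
    simpa only [h, map_zero, mul_zero, zero_mul, integral_zero] using this

end FieldEquation

/-! ### The equivalence with the Weyl equations. -/

theorem theorem1 {M : Type*} [TopologicalSpace M] [T2Space M] [ConnectedSpace M]
    [ChartedSpace E3 M] [IsManifold 𝓘(ℝ, E3) ∞ M]
    (g : RiemMetric M) (e : OrthonormalFrame g) (p₀ : ℝ) (hp₀ : p₀ ≠ 0)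
    (η : M → Spinor) (hη : ContMDiff 𝓘(ℝ, E3) 𝓘(ℝ, Spinor) 2 η) (hη0 : ∀ x, η x ≠ 0) :
    SolvesFieldEquation e p₀ η ↔ (SolvesWeyl e p₀ η ∨ SolvesWeyl e (-p₀) η) := by
  rw [solvesFieldEquation_iff_eulerLagrange e p₀ hη hη0]
  constructor
  · intro h
    -- Pairing with `η` removes the gradient of `u`.
    have hsq : ∀ x, weylRatio e η x ^ 2 = p₀ ^ 2 := by
      intro x
      have hρ := spinorForm_one_self_pos (hη0 x)
      have h1 := spinorForm_one_eulerLagrange e p₀ η x (η x)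
      have h2 : weylRatio e η x * spinorForm 1 (η x) (η x) =
          spinorForm 1 (η x) (weylOperator e η x) := by
        rw [← weylForm_re_eq_weylOperator]
        exact div_mul_cancel₀ _ hρ.ne'
      rw [h, map_zero, mul_assoc, ← h2] at h1
      simp only [spinorForm_pauli_self, mul_zero, Finset.sum_const_zero, zero_add] at h1
      have h3 : (weylRatio e η x ^ 2 - p₀ ^ 2) * spinorForm 1 (η x) (η x) = 0 := by linarith
      have := (mul_eq_zero.1 h3).resolve_right hρ.ne'
      linarith
    have hcont : Continuous (weylRatio e η) :=
      (contMDiff_weylRatio e (m := 1) (n := 2) hη (by norm_num) hη0).continuous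
    have hweyl : ∀ p : ℝ, p ^ 2 = p₀ ^ 2 → weylRatio e η = (fun _ => p) → SolvesWeyl e p η := by
      intro p hp hu
      rw [solvesWeyl_iff]
      intro x
      have hx := h x
      have hp0 : (p : ℂ) ≠ 0 := by
        have : p ≠ 0 := fun hp' => hp₀ (by simpa [hp'] using hp.symm)
        exact_mod_cast this
      simp only [eulerLagrange, hu, frameLineDeriv_const, ← hp, Complex.ofReal_zero, zero_smul,
        Finset.sum_const_zero, zero_add] at hx
      have h4 : ((2 * p : ℝ) : ℂ) • (weylOperator e η x - (p : ℂ) • η x) = 0 := by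
        rw [← hx, smul_sub, smul_smul]
        push_cast
        congr 2
        ring
      have := (smul_eq_zero.1 h4).resolve_left (by simpa using hp0)
      exact sub_eq_zero.1 this
    -- Connectedness and `p₀ ≠ 0` prevent the sign of `u` from changing between points.
    rcases isPreconnected_univ.eq_or_eq_neg_of_sq_eq (f := weylRatio e η) (g := fun _ => p₀)
      hcont.continuousOn continuousOn_const (fun x _ => hsq x) (fun _ => hp₀) with h5 | h5
    · exact .inl (hweyl p₀ rfl (funext fun x => h5 trivial))
    · exact .inr (hweyl (-p₀) (by ring) (funext fun x => h5 trivial))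
  · have hconv : ∀ p : ℝ, p ^ 2 = p₀ ^ 2 → SolvesWeyl e p η → ∀ x, eulerLagrange e p₀ η x = 0 := by
      intro p hp h x
      have hu : weylRatio e η = fun _ => p := funext (weylRatio_eq_of_solvesWeyl e hη0 h)
      rw [solvesWeyl_iff] at h
      simp only [eulerLagrange, hu, frameLineDeriv_const, ← hp, Complex.ofReal_zero, zero_smul,
        Finset.sum_const_zero, zero_add, h, smul_smul, ← sub_smul]
      rw [show ((2 * p : ℝ) : ℂ) * p - ((p ^ 2 + p ^ 2 : ℝ) : ℂ) = 0 by push_cast; ring, zero_smul]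
    rintro (h | h)
    · exact hconv p₀ rfl h
    · exact hconv (-p₀) (by ring) h
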